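/- Let $A=\bigoplus_{k\ge 0}A_k$ be a graded commutative $\mathbb C$-algebra generated by homogeneous elements $z_1,\dots,z_t$ of positive weights $m_1,\dots,m_t$, where $\{z_1,\dots,z_t\}$ is a minimal set of generators (no $z_i$ lies in the subalgebra generated by the others) and $\gcd(m_1,\dots,m_t)=1$. Put $m_A=\bigoplus_{k>0}A_k$ and let $0\in X=\operatorname{Spec}A$ be the corresponding point. Assume that $X$ is normal and regular outside $0$ (an isolated normal singularity; $0$ itself may be regular). Let $f\in A_d$ be homogeneous such that $X'=\operatorname{Spec}A/(f)$ is also normal and regular outside $0$. Let $I_s=\bigoplus_{k\ge s}A_k$, and let $\pi:Z=\operatorname{Proj}\bigl(\bigoplus_{s\ge 0}I_su^s\bigr)\to X$ (where $\bigoplus_{s\ge 0} I_su^s\subset A[u]$ is graded by the degree in $u$) be the weighted blow-up. Let $E=\pi^{-1}(0)$, and let $Z'\subset Z$ be the proper transform of $X'$, i.e. the closure of $\pi^{-1}(X'\setminus\{0\})$. **Proposition 1.1.** The condition $$(*)\qquad E\cap Z'\ \text{ is not contained in the singular locus of } Z$$ holds in each of the following two cases: 1. $f=z_j$ for some $j$,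 and the weights $m_i$ with $i\neq j$ have greatest common divisor $1$ (the gcd of the empty family being $0$); 2. $f\in m_A^2$. -/

import Mathlib

open AlgebraicGeometry CategoryTheory
open scoped Polynomial

universe u

/-! ### Normal rings and isolated singularities -/

/-- A commutative ring is normal if all its localizations at primes are integrally closed
domains. -/
def IsNormalRing (R : Type u) [CommRing R] : Prop :=
  ∀ (p : Ideal R) [p.IsPrime],
    IsDomain (Localization.AtPrime p) ∧ IsIntegrallyClosed (Localization.AtPrime p)

/-- `Spec R` has (at most) an isolated singularity at the point defined by the ideal `m`:
the local rings at all other points are regular. -/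
def HasIsolatedSingularityAt (R : Type u) [CommRing R] (m : Ideal R) : Prop :=
  ∀ (p : Ideal R) [p.IsPrime], p ≠ m → IsRegularLocalRing (Localization.AtPrime p)

/-- The singular locus of a scheme: the set of points whose local ring is not regular. -/
def singularLocus (Z : Scheme.{u}) : Set Z :=
  {x | ¬ IsRegularLocalRing (Z.presheaf.stalk x)}

/-! ### The blow-up of the weight filtration -/

namespace WeightBlowUp

variable {A : Type u} [CommRing A] [Algebra ℂ A] (𝒜 : ℕ → Submodule ℂ A) [GradedAlgebra 𝒜]

/-- Products respect the weight filtration. -/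
theorem decompose_mul_eq_zero {s t : ℕ} {a b : A}
    (ha : ∀ k < s, (DirectSum.decompose 𝒜 a k : A) = 0)
    (hb : ∀ k < t, (DirectSum.decompose 𝒜 b k : A) = 0) (k : ℕ) (hk : k < s + t) :
    (DirectSum.decompose 𝒜 (a * b) k : A) = 0 := by
  classical
  rw [DirectSum.decompose_mul, DirectSum.coe_mul_apply]
  refine Finset.sum_eq_zero fun ij hij => ?_
  have hsum := (Finset.mem_filter.mp hij).2
  rcases lt_or_ge ij.1 s with h | h
  · rw [ha _ h, zero_mul]
  · rw [hb _ (by omega), mul_zero]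

/-- The ideal `I_s = ⨁_{k ≥ s} A_k` of the weight filtration. -/
def weightIdeal (s : ℕ) : Ideal A where
  carrier := {a | ∀ k < s, (DirectSum.decompose 𝒜 a k : A) = 0}
  zero_mem' := fun k _ => by simp
  add_mem' := fun {a b} ha hb k hk => by simp [ha k hk, hb k hk]
  smul_mem' := fun c a ha k hk =>
    decompose_mul_eq_zero 𝒜 (s := 0) (fun _ h => absurd h (Nat.not_lt_zero _)) ha k (by omega)

theorem mem_weightIdeal {s : ℕ} {a : A} :
    a ∈ weightIdeal 𝒜 s ↔ ∀ k < s, (DirectSum.decompose 𝒜 a k : A) = 0 := Iff.rfl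

theorem mul_mem_weightIdeal {s t : ℕ} {a b : A} (ha : a ∈ weightIdeal 𝒜 s)
    (hb : b ∈ weightIdeal 𝒜 t) : a * b ∈ weightIdeal 𝒜 (s + t) :=
  fun k hk => decompose_mul_eq_zero 𝒜 ha hb k hk

theorem mem_weightIdeal_zero (a : A) : a ∈ weightIdeal 𝒜 0 :=
  fun _ h => absurd h (Nat.not_lt_zero _)

/-- The Rees algebra `⨁_s I_s u^s ⊆ A[u]` of the weight filtration. -/
def rees : Subalgebra A A[X] where
  carrier := {p | ∀ s, p.coeff s ∈ weightIdeal 𝒜 s}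
  mul_mem' := fun {p q} hp hq s => by
    rw [Polynomial.coeff_mul]
    refine Ideal.sum_mem _ fun ij hij => ?_
    rw [← Finset.HasAntidiagonal.mem_antidiagonal.mp hij]
    exact mul_mem_weightIdeal 𝒜 (hp _) (hq _)
  add_mem' := fun {p q} hp hq s => by
    rw [Polynomial.coeff_add]
    exact Ideal.add_mem _ (hp s) (hq s)
  algebraMap_mem' := fun a s => by
    rw [Polynomial.algebraMap_apply, Algebra.algebraMap_self, RingHom.id_apply,
      Polynomial.coeff_C]
    split_ifs with h
    · subst h
      exact mem_weightIdeal_zero 𝒜 a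
    · exact Ideal.zero_mem _

theorem mem_rees {p : A[X]} : p ∈ rees 𝒜 ↔ ∀ s, p.coeff s ∈ weightIdeal 𝒜 s := Iff.rfl

/-- The piece `I_s u^s` of the Rees algebra, of degree `s` in `u`. -/
def reesGrading (s : ℕ) : Submodule A (rees 𝒜) where
  carrier := {p | ∀ k, k ≠ s → (p : A[X]).coeff k = 0}
  zero_mem' := fun k _ => by simp
  add_mem' := fun {p q} hp hq k hk => by simp [hp k hk, hq k hk]
  smul_mem' := fun c p hp k hk => by simp [hp k hk]

theorem mem_reesGrading {s : ℕ} {p : rees 𝒜} :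
    p ∈ reesGrading 𝒜 s ↔ ∀ k, k ≠ s → (p : A[X]).coeff k = 0 := Iff.rfl

instance : SetLike.GradedMonoid (reesGrading 𝒜) where
  one_mem := fun k hk => by simp [Polynomial.coeff_one, hk]
  mul_mem := fun i j p q hp hq k hk => by
    rw [MulMemClass.coe_mul, Polynomial.coeff_mul]
    refine Finset.sum_eq_zero fun ab hab => ?_
    have hsum := Finset.HasAntidiagonal.mem_antidiagonal.mp hab
    by_cases h : ab.1 = i
    · rw [hq ab.2 (by omega), mul_zero]
    · rw [hp ab.1 h, zero_mul]

/-- The component of degree `s` in `u` of an element of the Rees algebra. -/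
noncomputable def reesComponent (p : rees 𝒜) (s : ℕ) : reesGrading 𝒜 s :=
  ⟨⟨Polynomial.monomial s ((p : A[X]).coeff s), fun k => by
      rw [Polynomial.coeff_monomial]
      split_ifs with h
      · subst h
        exact p.2 s
      · exact Ideal.zero_mem _⟩,
    fun _ hk => Polynomial.coeff_monomial_of_ne _ hk⟩

theorem coe_reesComponent (p : rees 𝒜) (s : ℕ) :
    ((reesComponent 𝒜 p s : rees 𝒜) : A[X]) = Polynomial.monomial s ((p : A[X]).coeff s) := rfl

theorem coeff_coeAddMonoidHom (x : DirectSum ℕ fun s => reesGrading 𝒜 s) (k : ℕ) :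
    ((DirectSum.coeAddMonoidHom (reesGrading 𝒜) x : rees 𝒜) : A[X]).coeff k =
      ((x k : rees 𝒜) : A[X]).coeff k := by
  classical
  induction x using DirectSum.induction_on with
  | zero => simp
  | of i y =>
    rw [DirectSum.coeAddMonoidHom_of]
    by_cases h : i = k
    · subst h
      rw [DirectSum.of_eq_same]
    · rw [DirectSum.of_eq_of_ne _ _ _ (Ne.symm h), y.2 k (Ne.symm h)]
      simp
  | add x y hx hy => simp [hx, hy]

/-- The Rees algebra is graded by the degree in `u`. -/
noncomputable instance : GradedAlgebra (reesGrading 𝒜) where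
  decompose' p := DirectSum.mk _ (p : A[X]).support fun s => reesComponent 𝒜 p s
  left_inv p := by
    classical
    apply Subtype.ext
    ext k
    rw [coeff_coeAddMonoidHom]
    by_cases h : k ∈ (p : A[X]).support
    · rw [DirectSum.mk_apply_of_mem h, coe_reesComponent, Polynomial.coeff_monomial_same]
    · rw [DirectSum.mk_apply_of_notMem h, Polynomial.notMem_support_iff.mp h]
      simp
  right_inv x := by
    classical
    refine DFinsupp.ext fun k => Subtype.ext (Subtype.ext ?_)
    ext n
    by_cases hn : n = k
    · subst hn
      rw [← coeff_coeAddMonoidHom 𝒜 x n]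
      by_cases h : n ∈ ((DirectSum.coeAddMonoidHom (reesGrading 𝒜) x : rees 𝒜) : A[X]).support
      · rw [DirectSum.mk_apply_of_mem h, coe_reesComponent, Polynomial.coeff_monomial_same]
      · rw [DirectSum.mk_apply_of_notMem h, Polynomial.notMem_support_iff.mp h]
        simp
    · rw [((_ : reesGrading 𝒜 k)).2 n hn, (x k).2 n hn]

/-- The weighted blow-up `Z = Proj (⨁_s I_s u^s)`. -/
noncomputable def blowUp : Scheme.{u} := Proj (reesGrading 𝒜)

/-- The structure morphism `π : Z ⟶ X = Spec A`, given by `A = I_0`, the degree zero part of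
the Rees algebra. -/
noncomputable def toBase : blowUp 𝒜 ⟶ Spec (.of A) :=
  Proj.toSpecZero (reesGrading 𝒜) ≫
    Spec.map (CommRingCat.ofHom (algebraMap A (reesGrading 𝒜 0)))

/-- The ideal `m_A = ⨁_{k > 0} A_k` of the point `0 ∈ X` (the vertex). -/
def vertexIdeal : Ideal A := (HomogeneousIdeal.irrelevant 𝒜).toIdeal

/-- The set `{0} ⊆ X`. -/
def vertex : Set (Spec (.of A)) := PrimeSpectrum.zeroLocus (vertexIdeal 𝒜 : Set A)

/-- The exceptional fibre `E = π⁻¹(0)`. -/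
def exceptionalSet : Set (blowUp 𝒜) := toBase 𝒜 ⁻¹' vertex 𝒜

/-- The proper transform `Z'` of `X' = {f = 0}`: the closure in `Z` of `π⁻¹(X' ∖ {0})`. -/
def properTransform (f : A) : Set (blowUp 𝒜) :=
  closure (toBase 𝒜 ⁻¹' (PrimeSpectrum.zeroLocus {f} \ vertex 𝒜))

/-- Condition `(*)`: `E ∩ Z'` is not contained in the singular locus of `Z`. -/
def ConditionStar (f : A) : Prop :=
  ¬ (exceptionalSet 𝒜 ∩ properTransform 𝒜 f ⊆ singularLocus (blowUp 𝒜))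

end WeightBlowUp

/-! Put `P = (f)`. A connected graded ring that is normal is a domain, so `A` is a domain and `P` is
a homogeneous prime (`ker_isPrime_of_isNormalRing`). Minimality of the generators keeps a set of `z
i` with coprime weights outside `P`: all but `z j` in the first case, all of them in the second.
Hence there are homogeneous elements outside `P` of consecutive degrees
(`exists_consecutive_degrees`), and their quotient `T` is a unit of degree one.

Let `R` be the degree zero part of the homogeneous localization of `A` at `P`. The unit `T` has two
uses. On `X`: sending a homogeneous `a` of degree `n` to `(a / Tⁿ) Xⁿ` embeds `A` in `R[X]` with `X`
in the role of `T`. After the shift `X ↦ X + 1`, the local ring of `R[X]` at the origin becomes the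
local ring of `A` at a prime (`localRingHom_bijective`). This prime is not the vertex, so the ring
is regular. On `Z`: the exceptional divisor has local equation `T`, and taking leading components
retracts the local ring onto `R`. The stalk at the generic point of `E ∩ Z'` given by `P` is
therefore the localization of `R[T]` at the origin (`ofLocalization_bijective`). The two local rings
are isomorphic, so `Z` is regular at that point of `E ∩ Z'`. -/

namespace WeightBlowUp

set_option linter.unusedSectionVars false

/-! ### Connected graded algebras, minimal generators and degrees outside a prime -/

section Graded

variable {A : Type u} [CommRing A] [Algebra ℂ A] (𝒜 : ℕ → Submodule ℂ A) [GradedAlgebra 𝒜]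

theorem mem_vertexIdeal {a : A} :
    a ∈ vertexIdeal 𝒜 ↔ (DirectSum.decompose 𝒜 a 0 : A) = 0 :=
  HomogeneousIdeal.mem_irrelevant_iff 𝒜 a

theorem mem_vertexIdeal_of_mem {k : ℕ} (hk : 0 < k) {a : A} (ha : a ∈ 𝒜 k) :
    a ∈ vertexIdeal 𝒜 :=
  HomogeneousIdeal.mem_irrelevant_of_mem 𝒜 hk ha

theorem algebraMap_mem_zero (c : ℂ) : algebraMap ℂ A c ∈ 𝒜 0 :=
  SetLike.algebraMap_mem_graded 𝒜 c

/-- If generators have positive weights, every element is constant modulo the vertex ideal. -/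
theorem exists_sub_algebraMap_mem_vertexIdeal {ι : Type*} {z : ι → A} {m : ι → ℕ}
    (hm_pos : ∀ i, 0 < m i) (hz_mem : ∀ i, z i ∈ 𝒜 (m i))
    (hz_gen : Algebra.adjoin ℂ (Set.range z) = ⊤) (a : A) :
    ∃ c : ℂ, a - algebraMap ℂ A c ∈ vertexIdeal 𝒜 := by
  have ha : a ∈ Algebra.adjoin ℂ (Set.range z) := hz_gen ▸ Algebra.mem_top
  induction ha using Algebra.adjoin_induction with
  | mem x hx =>
    obtain ⟨i, rfl⟩ := hx
    exact ⟨0, by simpa using mem_vertexIdeal_of_mem 𝒜 (hm_pos i) (hz_mem i)⟩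
  | algebraMap r => exact ⟨r, by simp⟩
  | add x y _ _ hx hy =>
    obtain ⟨c, hc⟩ := hx
    obtain ⟨e, he⟩ := hy
    refine ⟨c + e, ?_⟩
    convert Ideal.add_mem _ hc he using 1
    rw [map_add]
    ring
  | mul x y _ _ hx hy =>
    obtain ⟨c, hc⟩ := hx
    obtain ⟨e, he⟩ := hy
    refine ⟨c * e, ?_⟩
    convert Ideal.add_mem _ (Ideal.mul_mem_right y _ hc)
      (Ideal.mul_mem_left _ (algebraMap ℂ A c) he) using 1
    rw [map_mul]
    ring

variable {𝒜}

/-- Modulo the vertex ideal every element is a scalar, and a nonzero scalar in the ideal would put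
`1` in it. -/
theorem vertexIdeal_isPrime [Nontrivial A]
    (hconn : ∀ a : A, ∃ c : ℂ, a - algebraMap ℂ A c ∈ vertexIdeal 𝒜) :
    (vertexIdeal 𝒜).IsPrime := by
  have hone : (1 : A) ∉ vertexIdeal 𝒜 := fun h => by
    rw [mem_vertexIdeal, DirectSum.decompose_of_mem_same 𝒜 SetLike.GradedOne.one_mem] at h
    exact one_ne_zero h
  refine ⟨(Ideal.ne_top_iff_one _).mpr hone, fun {a b} hab => ?_⟩
  obtain ⟨c, hc⟩ := hconn a
  obtain ⟨e, he⟩ := hconn b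
  have hce : algebraMap ℂ A (c * e) ∈ vertexIdeal 𝒜 := by
    have h := Ideal.sub_mem _ hab (Ideal.add_mem _ (Ideal.mul_mem_right b _ hc)
      (Ideal.mul_mem_left _ (algebraMap ℂ A c) he))
    convert h using 1
    rw [map_mul]
    ring
  have h0 : c * e = 0 := by
    by_contra h
    apply hone
    have := Ideal.mul_mem_left _ (algebraMap ℂ A (c * e)⁻¹) hce
    rwa [← map_mul, inv_mul_cancel₀ h, map_one] at this
  rcases mul_eq_zero.mp h0 with rfl | rfl
  · left
    simpa using hc
  · right
    simpa using he

/-- A graded quotient of a connected graded algebra is a domain as soon as it is normal. -/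
theorem ker_isPrime_of_isNormalRing [Nontrivial A]
    (hconn : ∀ a : A, ∃ c : ℂ, a - algebraMap ℂ A c ∈ vertexIdeal 𝒜)
    {B : Type u} [CommRing B] (π : A →+* B) (hπ : Function.Surjective π)
    (hhom : (RingHom.ker π).IsHomogeneous 𝒜) (hle : RingHom.ker π ≤ vertexIdeal 𝒜)
    (hB : IsNormalRing B) : (RingHom.ker π).IsPrime := by
  have hprime := vertexIdeal_isPrime hconn
  have hpB : ((vertexIdeal 𝒜).map π).IsPrime := Ideal.map_isPrime_of_surjective hπ hle
  have hdom := (hB ((vertexIdeal 𝒜).map π)).1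
  -- Homogeneous elements outside the kernel survive in the local ring of `B` at the vertex. If `s`
  -- kills `π x` and lies outside the vertex ideal, then its constant component is a scalar `c ≠ 0`,
  -- and the component of `s * x` in the degree of `x` is `c x`.
  have key : ∀ {i : ℕ} {x : A}, x ∈ 𝒜 i →
      algebraMap B (Localization.AtPrime ((vertexIdeal 𝒜).map π)) (π x) = 0 →
      x ∈ RingHom.ker π := by
    intro i x hx h0
    obtain ⟨⟨s, hs⟩, hsx⟩ := (IsLocalization.map_eq_zero_iff
      ((vertexIdeal 𝒜).map π).primeCompl _ _).mp h0
    obtain ⟨s, rfl⟩ := hπ s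
    have hs' : s ∉ vertexIdeal 𝒜 := fun h => hs (Ideal.mem_map_of_mem π h)
    obtain ⟨c, hc⟩ := hconn s
    have hc0 : c ≠ 0 := by
      rintro rfl
      exact hs' (by simpa using hc)
    have hs0 : (DirectSum.decompose 𝒜 s 0 : A) = algebraMap ℂ A c := by
      have h := (mem_vertexIdeal 𝒜).mp hc
      rw [DirectSum.decompose_sub, DirectSum.sub_apply, AddSubgroupClass.coe_sub,
        DirectSum.decompose_of_mem_same 𝒜 (algebraMap_mem_zero 𝒜 c), sub_eq_zero] at h
      exact h
    have hsx' : s * x ∈ RingHom.ker π := by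
      rw [RingHom.mem_ker, map_mul]
      exact hsx
    have h1 := hhom i hsx'
    have h2 := DirectSum.coe_decompose_mul_add_of_right_mem 𝒜 (i := 0) (a := s) hx
    rw [zero_add] at h2
    rw [h2, hs0] at h1
    have := Ideal.mul_mem_left _ (algebraMap ℂ A c⁻¹) h1
    rwa [← mul_assoc, ← map_mul, inv_mul_cancel₀ hc0, map_one, one_mul] at this
  refine Ideal.IsHomogeneous.isPrime_of_homogeneous_mem_or_mem hhom ?_ ?_
  · intro h
    exact hprime.ne_top (top_le_iff.mp (h ▸ hle))
  · rintro x y ⟨i, hx⟩ ⟨j, hy⟩ hxy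
    have h0 : algebraMap B (Localization.AtPrime ((vertexIdeal 𝒜).map π)) (π x) *
        algebraMap B (Localization.AtPrime ((vertexIdeal 𝒜).map π)) (π y) = 0 := by
      rw [← map_mul, ← map_mul, RingHom.mem_ker.mp hxy, map_zero]
    exact (mul_eq_zero.mp h0).imp (key hx) (key hy)

/-- Components of degree below `m i` only involve the generators other than `z i`. -/
theorem decompose_mem_adjoin_of_lt {ι : Type*} {z : ι → A} {m : ι → ℕ}
    (hz_mem : ∀ i, z i ∈ 𝒜 (m i))
    (hz_gen : Algebra.adjoin ℂ (Set.range z) = ⊤) (i : ι) (a : A) (n : ℕ) (hn : n < m i) :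
    (DirectSum.decompose 𝒜 a n : A) ∈ Algebra.adjoin ℂ (z '' {i}ᶜ) := by
  classical
  have ha : a ∈ Algebra.adjoin ℂ (Set.range z) := hz_gen ▸ Algebra.mem_top
  induction ha using Algebra.adjoin_induction generalizing n with
  | mem x hx =>
    obtain ⟨j, rfl⟩ := hx
    by_cases hj : m j = n
    · subst hj
      rw [DirectSum.decompose_of_mem_same 𝒜 (hz_mem j)]
      refine Algebra.subset_adjoin ⟨j, ?_, rfl⟩
      rintro rfl
      exact lt_irrefl _ hn
    · rw [DirectSum.decompose_of_mem_ne 𝒜 (hz_mem j) hj]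
      exact zero_mem _
  | algebraMap r =>
    by_cases h0 : 0 = n
    · subst h0
      rw [DirectSum.decompose_of_mem_same 𝒜 (algebraMap_mem_zero 𝒜 r)]
      exact Subalgebra.algebraMap_mem _ r
    · rw [DirectSum.decompose_of_mem_ne 𝒜 (algebraMap_mem_zero 𝒜 r) h0]
      exact zero_mem _
  | add x y _ _ hx hy =>
    rw [DirectSum.decompose_add, DirectSum.add_apply, Submodule.coe_add]
    exact add_mem (hx n hn) (hy n hn)
  | mul x y _ _ hx hy =>
    rw [DirectSum.decompose_mul, DirectSum.coe_mul_apply]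
    refine sum_mem fun jk hjk => ?_
    have := (Finset.mem_filter.mp hjk).2
    exact mul_mem (hx _ (by omega)) (hy _ (by omega))

/-- A minimal generator does not lie in the square of the vertex ideal. -/
theorem notMem_vertexIdeal_sq {ι : Type*} {z : ι → A} {m : ι → ℕ}
    (hz_mem : ∀ i, z i ∈ 𝒜 (m i))
    (hz_gen : Algebra.adjoin ℂ (Set.range z) = ⊤) (i : ι)
    (hz_min : z i ∉ Algebra.adjoin ℂ (z '' {i}ᶜ)) : z i ∉ vertexIdeal 𝒜 ^ 2 := by
  classical
  intro hi
  apply hz_min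
  rw [← DirectSum.decompose_of_mem_same 𝒜 (hz_mem i)]
  rw [pow_two] at hi
  -- The degree `m i` stays fixed while the element varies: the claim becomes that the component of
  -- degree `m i` of any element of the square lies in the subalgebra. Factors of degree zero
  -- contribute nothing, so both degrees are below `m i`.
  generalize z i = a at hi
  induction hi using Submodule.mul_induction_on' with
  | mem_mul_mem x hx y hy =>
    rw [mem_vertexIdeal] at hx hy
    rw [DirectSum.decompose_mul, DirectSum.coe_mul_apply]
    refine sum_mem fun jk hjk => ?_
    have hsum := (Finset.mem_filter.mp hjk).2
    rcases Nat.eq_zero_or_pos jk.1 with h1 | h1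
    · rw [h1, hx, zero_mul]
      exact zero_mem _
    rcases Nat.eq_zero_or_pos jk.2 with h2 | h2
    · rw [h2, hy, mul_zero]
      exact zero_mem _
    exact mul_mem (decompose_mem_adjoin_of_lt hz_mem hz_gen i _ _ (by omega))
      (decompose_mem_adjoin_of_lt hz_mem hz_gen i _ _ (by omega))
  | add x _ y _ hx hy =>
    rw [DirectSum.decompose_add, DirectSum.add_apply, Submodule.coe_add]
    exact add_mem hx hy

/-- A minimal generator is not a multiple of another one. -/
theorem notMem_span_singleton {ι : Type*} {z : ι → A} {m : ι → ℕ}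
    (hm_pos : ∀ i, 0 < m i) (hz_mem : ∀ i, z i ∈ 𝒜 (m i))
    (hz_gen : Algebra.adjoin ℂ (Set.range z) = ⊤) {i j : ι} (hij : j ≠ i)
    (hz_min : z i ∉ Algebra.adjoin ℂ (z '' {i}ᶜ)) : z i ∉ Ideal.span {z j} := by
  classical
  intro hi
  obtain ⟨a, ha⟩ := Ideal.mem_span_singleton'.mp hi
  apply hz_min
  rw [← DirectSum.decompose_of_mem_same 𝒜 (hz_mem i), ← ha, DirectSum.decompose_mul,
    DirectSum.coe_mul_apply]
  refine sum_mem fun kl hkl => ?_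
  have hsum := (Finset.mem_filter.mp hkl).2
  -- Only the pair with second degree `m j` contributes, and `m j > 0` puts its first degree below
  -- `m i`.
  by_cases h : m j = kl.2
  · have hpos := hm_pos j
    refine mul_mem (decompose_mem_adjoin_of_lt hz_mem hz_gen i _ _ (by omega)) ?_
    rw [← h, DirectSum.decompose_of_mem_same 𝒜 (hz_mem j)]
    exact Algebra.subset_adjoin ⟨j, hij, rfl⟩
  · rw [DirectSum.decompose_of_mem_ne 𝒜 (hz_mem j) h, mul_zero]
    exact zero_mem _

/-- If homogeneous elements outside a prime have coprime degrees, then two homogeneous elements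
outside that prime have consecutive degrees. -/
theorem exists_consecutive_degrees {ι : Type*} {z : ι → A} {m : ι → ℕ}
    (hz_mem : ∀ i, z i ∈ 𝒜 (m i)) (P : Ideal A) [P.IsPrime] (S : Finset ι)
    (hS : ∀ i ∈ S, z i ∉ P) (hgcd : S.gcd m = 1) :
    ∃ (k : ℕ) (g₀ g₁ : A), g₀ ∈ 𝒜 k ∧ g₁ ∈ 𝒜 (k + 1) ∧ g₀ ∉ P ∧ g₁ ∉ P := by
  have hP : (1 : A) ∉ P := (Ideal.ne_top_iff_one _).mp (Ideal.IsPrime.ne_top ‹_›)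
  have hmul : ∀ {a b : A}, a ∉ P → b ∉ P → a * b ∉ P := fun ha hb h =>
    (Ideal.IsPrime.mem_or_mem ‹_› h).elim ha hb
  -- The differences of degrees of homogeneous elements outside `P` form a subgroup because `P` is
  -- prime. Its generator divides every `m i` with `i ∈ S`, hence is `±1`.
  let H : AddSubgroup ℤ :=
    { carrier := {n | ∃ (j k : ℕ) (a b : A), a ∈ 𝒜 j ∧ b ∈ 𝒜 k ∧ a ∉ P ∧ b ∉ P ∧
        n = (j : ℤ) - k}
      zero_mem' := ⟨0, 0, 1, 1, SetLike.GradedOne.one_mem, SetLike.GradedOne.one_mem, hP, hP,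
        by simp⟩
      add_mem' := by
        rintro _ _ ⟨j, k, a, b, ha, hb, ha', hb', rfl⟩ ⟨j', k', a', b', hc, hd, hc', hd', rfl⟩
        exact ⟨j + j', k + k', a * a', b * b', SetLike.mul_mem_graded ha hc,
          SetLike.mul_mem_graded hb hd, hmul ha' hc', hmul hb' hd', by push_cast; ring⟩
      neg_mem' := by
        rintro _ ⟨j, k, a, b, ha, hb, ha', hb', rfl⟩
        exact ⟨k, j, b, a, hb, ha, hb', ha', by ring⟩ }
  obtain ⟨g, hg⟩ := Int.subgroup_cyclic H
  have hdvd : ∀ i ∈ S, g.natAbs ∣ m i := by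
    intro i hi
    have hiH : (m i : ℤ) ∈ H :=
      ⟨m i, 0, z i, 1, hz_mem i, SetLike.GradedOne.one_mem, hS i hi, hP, by simp⟩
    rw [hg, AddSubgroup.mem_closure_singleton] at hiH
    obtain ⟨n, hn⟩ := hiH
    rw [smul_eq_mul] at hn
    rw [← Int.natCast_dvd_natCast, Int.natCast_natAbs, abs_dvd]
    exact ⟨n, by rw [← hn, mul_comm]⟩
  have h1 : g.natAbs = 1 := Nat.dvd_one.mp (hgcd ▸ Finset.dvd_gcd hdvd)
  have hgH : g ∈ H := hg ▸ AddSubgroup.subset_closure rfl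
  have h1H : (1 : ℤ) ∈ H := by
    rcases Int.natAbs_eq_iff.mp h1 with rfl | rfl
    · exact hgH
    · simpa using H.neg_mem hgH
  obtain ⟨j, k, a, b, ha, hb, ha', hb', h⟩ := h1H
  obtain rfl : j = k + 1 := by omega
  exact ⟨k, b, a, hb, ha, hb', ha'⟩

end Graded

/-! ### Homomorphisms out of a graded ring -/

section GradedLift

variable {A σ : Type*} [CommRing A] [SetLike σ A] [AddSubgroupClass σ A] {𝒜 : ℕ → σ}
  [GradedRing 𝒜] {B : Type*} [CommRing B]

/-- A ring homomorphism out of an internally graded ring, given on the graded pieces. -/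
def gradedLift (f : ∀ n, 𝒜 n →+ B) (hone : f 0 ⟨1, SetLike.GradedOne.one_mem⟩ = 1)
    (hmul : ∀ (i j : ℕ) (a : 𝒜 i) (b : 𝒜 j),
      f (i + j) ⟨a * b, SetLike.mul_mem_graded a.2 b.2⟩ = f i a * f j b) : A →+* B :=
  (DirectSum.toSemiring (A := fun i => 𝒜 i) f hone (hmul _ _)).comp
    (DirectSum.decomposeRingEquiv 𝒜).toRingHom

theorem gradedLift_of_mem (f : ∀ n, 𝒜 n →+ B) (hone : f 0 ⟨1, SetLike.GradedOne.one_mem⟩ = 1)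
    (hmul : ∀ (i j : ℕ) (a : 𝒜 i) (b : 𝒜 j),
      f (i + j) ⟨a * b, SetLike.mul_mem_graded a.2 b.2⟩ = f i a * f j b)
    {n : ℕ} {a : A} (ha : a ∈ 𝒜 n) : gradedLift f hone hmul a = f n ⟨a, ha⟩ := by
  change DirectSum.toSemiring f hone (hmul _ _) (DirectSum.decompose 𝒜 a) = _
  rw [DirectSum.decompose_of_mem 𝒜 ha, DirectSum.toSemiring_of]

end GradedLift

/-! ### Degree zero fractions with denominator outside a prime -/

section HomogeneousFraction

variable {A σ : Type*} [CommRing A] [SetLike σ A] [AddSubgroupClass σ A] (𝒜 : ℕ → σ)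
  [GradedRing 𝒜] (P : Ideal A) [P.IsPrime]

/-- The fraction `a / b` of two homogeneous elements of the same degree, with `b ∉ P`. -/
def homFrac {n : ℕ} (a b : A) (ha : a ∈ 𝒜 n) (hb : b ∈ 𝒜 n) (hbP : b ∉ P) :
    HomogeneousLocalization.AtPrime 𝒜 P :=
  HomogeneousLocalization.mk ⟨n, ⟨a, ha⟩, ⟨b, hb⟩, hbP⟩

variable {𝒜 P}

theorem homFrac_val {n : ℕ} {a b : A} (ha : a ∈ 𝒜 n) (hb : b ∈ 𝒜 n) (hbP : b ∉ P) :
    (homFrac 𝒜 P a b ha hb hbP).val = Localization.mk a (⟨b, hbP⟩ : P.primeCompl) := rfl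

theorem exists_eq_homFrac (x : HomogeneousLocalization.AtPrime 𝒜 P) :
    ∃ (n : ℕ) (a b : A) (ha : a ∈ 𝒜 n) (hb : b ∈ 𝒜 n) (hbP : b ∉ P),
      x = homFrac 𝒜 P a b ha hb hbP := by
  obtain ⟨⟨n, ⟨a, ha⟩, ⟨b, hb⟩, hbP⟩, rfl⟩ := HomogeneousLocalization.mk_surjective x
  exact ⟨n, a, b, ha, hb, hbP, rfl⟩

/-- The two fractions may be written in different degrees. Most later identities between fractions
reduce through this to an equation between numerators and denominators. -/
theorem homFrac_eq {n l : ℕ} {a b c d : A} (ha : a ∈ 𝒜 n) (hb : b ∈ 𝒜 n) (hbP : b ∉ P)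
    (hc : c ∈ 𝒜 l) (hd : d ∈ 𝒜 l) (hdP : d ∉ P) (h : a * d = c * b) :
    homFrac 𝒜 P a b ha hb hbP = homFrac 𝒜 P c d hc hd hdP := by
  apply HomogeneousLocalization.val_injective
  rw [homFrac_val, homFrac_val, Localization.mk_eq_mk_iff, Localization.r_iff_exists]
  exact ⟨1, by simpa [mul_comm] using h⟩

theorem homFrac_add {n : ℕ} {a b c : A} (ha : a ∈ 𝒜 n) (hb : b ∈ 𝒜 n) (hbP : b ∉ P)
    (hc : c ∈ 𝒜 n) :
    homFrac 𝒜 P (a + c) b (add_mem ha hc) hb hbP =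
      homFrac 𝒜 P a b ha hb hbP + homFrac 𝒜 P c b hc hb hbP := by
  apply HomogeneousLocalization.val_injective
  rw [HomogeneousLocalization.val_add, homFrac_val, homFrac_val, homFrac_val,
    Localization.add_mk_self]

theorem notMem_mul {a b : A} (ha : a ∉ P) (hb : b ∉ P) : a * b ∉ P := fun h =>
  (Ideal.IsPrime.mem_or_mem ‹_› h).elim ha hb

theorem notMem_pow {a : A} (ha : a ∉ P) (n : ℕ) : a ^ n ∉ P := fun h =>
  ha (Ideal.IsPrime.mem_of_pow_mem ‹_› n h)

theorem homFrac_mul {n l : ℕ} {a b c d : A} (ha : a ∈ 𝒜 n) (hb : b ∈ 𝒜 n) (hbP : b ∉ P)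
    (hc : c ∈ 𝒜 l) (hd : d ∈ 𝒜 l) (hdP : d ∉ P) :
    homFrac 𝒜 P a b ha hb hbP * homFrac 𝒜 P c d hc hd hdP =
      homFrac 𝒜 P (a * c) (b * d) (SetLike.mul_mem_graded ha hc)
        (SetLike.mul_mem_graded hb hd) (notMem_mul hbP hdP) := by
  apply HomogeneousLocalization.val_injective
  rw [HomogeneousLocalization.val_mul, homFrac_val, homFrac_val, homFrac_val,
    Localization.mk_mul]
  rfl

theorem homFrac_self {n : ℕ} {a : A} (ha : a ∈ 𝒜 n) (haP : a ∉ P) :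
    homFrac 𝒜 P a a ha ha haP = 1 := by
  apply HomogeneousLocalization.val_injective
  rw [HomogeneousLocalization.val_one, homFrac_val]
  exact Localization.mk_self (⟨a, haP⟩ : P.primeCompl)

theorem homFrac_zero {n : ℕ} {b : A} (hb : b ∈ 𝒜 n) (hbP : b ∉ P) :
    homFrac 𝒜 P 0 b (zero_mem _) hb hbP = 0 := by
  apply HomogeneousLocalization.val_injective
  rw [HomogeneousLocalization.val_zero, homFrac_val, Localization.mk_zero]

theorem isUnit_homFrac_iff {n : ℕ} {a b : A} (ha : a ∈ 𝒜 n) (hb : b ∈ 𝒜 n) (hbP : b ∉ P) :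
    IsUnit (homFrac 𝒜 P a b ha hb hbP) ↔ a ∉ P := by
  rw [← HomogeneousLocalization.isUnit_iff_isUnit_val, homFrac_val, Localization.mk_eq_mk',
    IsLocalization.AtPrime.isUnit_mk'_iff (Localization.AtPrime P) P]
  rfl

theorem homFrac_eq_zero_iff [IsDomain A] {n : ℕ} {a b : A} (ha : a ∈ 𝒜 n) (hb : b ∈ 𝒜 n)
    (hbP : b ∉ P) : homFrac 𝒜 P a b ha hb hbP = 0 ↔ a = 0 := by
  constructor
  · intro h
    have h1 := congrArg HomogeneousLocalization.val h
    rw [homFrac_val, HomogeneousLocalization.val_zero, Localization.mk_eq_mk',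
      IsLocalization.mk'_eq_zero_iff] at h1
    obtain ⟨⟨s, hs⟩, h⟩ := h1
    refine (mul_eq_zero.mp h).resolve_left ?_
    rintro rfl
    exact hs P.zero_mem
  · rintro rfl
    exact homFrac_zero hb hbP

instance [IsDomain A] : IsDomain (HomogeneousLocalization.AtPrime 𝒜 P) := by
  have : IsDomain (Localization P.primeCompl) :=
    IsLocalization.isDomain_localization P.primeCompl_le_nonZeroDivisors
  exact Function.Injective.isDomain
    (algebraMap (HomogeneousLocalization.AtPrime 𝒜 P) (Localization P.primeCompl))
    (HomogeneousLocalization.val_injective _)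

/-! ### A unit of degree one and the embedding of `A` in a polynomial ring -/

variable (𝒜 P)

/-- A homogeneous fraction `num / den` of degree one whose numerator and denominator are not
in `P`. -/
structure DegreeOneUnit where
  /-- the degree of the denominator -/
  deg : ℕ
  /-- the numerator -/
  num : A
  /-- the denominator -/
  den : A
  num_mem : num ∈ 𝒜 (deg + 1)
  den_mem : den ∈ 𝒜 deg
  num_notMem : num ∉ P
  den_notMem : den ∉ P

variable {𝒜 P}

namespace DegreeOneUnit

variable (T : DegreeOneUnit 𝒜 P)

theorem mul_den_pow_mem {n : ℕ} {a : A} (ha : a ∈ 𝒜 n) :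
    a * T.den ^ n ∈ 𝒜 (n * (T.deg + 1)) := by
  have := SetLike.mul_mem_graded ha (SetLike.pow_mem_graded n T.den_mem)
  rwa [smul_eq_mul, show n + n * T.deg = n * (T.deg + 1) by ring] at this

theorem num_pow_mem (n : ℕ) : T.num ^ n ∈ 𝒜 (n * (T.deg + 1)) :=
  SetLike.pow_mem_graded n T.num_mem

/-- The degree zero fraction `a / Tⁿ`. -/
def divPow {n : ℕ} (a : A) (ha : a ∈ 𝒜 n) : HomogeneousLocalization.AtPrime 𝒜 P :=
  homFrac 𝒜 P (a * T.den ^ n) (T.num ^ n) (T.mul_den_pow_mem ha) (T.num_pow_mem n)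
    (notMem_pow T.num_notMem n)

theorem divPow_add {n : ℕ} {a b : A} (ha : a ∈ 𝒜 n) (hb : b ∈ 𝒜 n) :
    T.divPow (a + b) (add_mem ha hb) = T.divPow a ha + T.divPow b hb := by
  unfold divPow
  rw [← homFrac_add]
  exact homFrac_eq _ _ _ _ _ _ (by ring)

theorem divPow_mul {n l : ℕ} {a b : A} (ha : a ∈ 𝒜 n) (hb : b ∈ 𝒜 l) :
    T.divPow (a * b) (SetLike.mul_mem_graded ha hb) = T.divPow a ha * T.divPow b hb := by
  unfold divPow
  rw [homFrac_mul]
  exact homFrac_eq _ _ _ _ _ _ (by ring)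

theorem divPow_zero {n : ℕ} : T.divPow (n := n) 0 (zero_mem _) = 0 := by
  rw [← homFrac_zero (T.num_pow_mem n) (notMem_pow T.num_notMem n)]
  exact homFrac_eq _ _ _ _ _ _ (by ring)

theorem divPow_one : T.divPow (n := 0) 1 SetLike.GradedOne.one_mem = 1 := by
  rw [← homFrac_self (P := P) (𝒜 := 𝒜) (a := (1 : A)) SetLike.GradedOne.one_mem
    ((Ideal.ne_top_iff_one _).mp (Ideal.IsPrime.ne_top ‹_›))]
  exact homFrac_eq _ _ _ _ _ _ (by ring)

theorem isUnit_divPow {n : ℕ} {a : A} (ha : a ∈ 𝒜 n) (haP : a ∉ P) :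
    IsUnit (T.divPow a ha) :=
  (isUnit_homFrac_iff _ _ _).mpr (notMem_mul haP (notMem_pow T.den_notMem n))

theorem divPow_eq_zero_iff [IsDomain A] {n : ℕ} {a : A} (ha : a ∈ 𝒜 n) :
    T.divPow a ha = 0 ↔ a = 0 := by
  have : T.den ≠ 0 := fun h => T.den_notMem (h ▸ P.zero_mem)
  rw [divPow, homFrac_eq_zero_iff, mul_eq_zero, or_iff_left (pow_ne_zero n this)]

/-- The homomorphism `∑ aₙ ↦ ∑ (aₙ / Tⁿ) Xⁿ`. -/
noncomputable def toPolynomial : A →+* (HomogeneousLocalization.AtPrime 𝒜 P)[X] :=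
  gradedLift (𝒜 := 𝒜)
    (fun n => AddMonoidHom.mk' (fun a => Polynomial.monomial n (T.divPow a.1 a.2))
      (fun a b => by rw [← map_add, ← divPow_add]; rfl))
    (by
      rw [← Polynomial.monomial_zero_one, ← T.divPow_one]
      rfl)
    (fun i j a b => by
      simp only [AddMonoidHom.mk'_apply]
      rw [Polynomial.monomial_mul_monomial, ← divPow_mul])

theorem toPolynomial_of_mem {n : ℕ} {a : A} (ha : a ∈ 𝒜 n) :
    T.toPolynomial a = Polynomial.monomial n (T.divPow a ha) := by
  rw [toPolynomial, gradedLift_of_mem (ha := ha)]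
  rfl

theorem coeff_toPolynomial (a : A) (n : ℕ) : (T.toPolynomial a).coeff n =
    T.divPow (DirectSum.decompose 𝒜 a n : A) (SetLike.coe_mem _) := by
  induction a using DirectSum.Decomposition.inductionOn 𝒜 with
  | zero => simp [divPow_zero]
  | @homogeneous i a =>
    rw [T.toPolynomial_of_mem a.2, Polynomial.coeff_monomial]
    split_ifs with h
    · subst h
      congr 1
      rw [DirectSum.decompose_of_mem_same 𝒜 a.2]
    · rw [← T.divPow_zero]
      congr 1
      rw [DirectSum.decompose_of_mem_ne 𝒜 a.2 h]
  | add a b ha hb =>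
    rw [map_add, Polynomial.coeff_add, ha, hb, ← divPow_add]
    congr 1
    rw [DirectSum.decompose_add, DirectSum.add_apply]
    rfl

/-- The coefficient of `Xⁿ` is `aₙ / Tⁿ`, which vanishes only if `aₙ` does. -/
theorem toPolynomial_injective [IsDomain A] : Function.Injective T.toPolynomial := by
  rw [injective_iff_map_eq_zero]
  intro a ha
  classical
  rw [← DirectSum.sum_support_decompose 𝒜 a]
  refine Finset.sum_eq_zero fun n _ => ?_
  rw [← T.divPow_eq_zero_iff (SetLike.coe_mem _), ← T.coeff_toPolynomial, ha, Polynomial.coeff_zero]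

/-- Every polynomial is a fraction of elements in the image of `toPolynomial`. -/
theorem exists_toPolynomial_mul (y : (HomogeneousLocalization.AtPrime 𝒜 P)[X]) :
    ∃ (n : ℕ) (b : A) (_ : b ∈ 𝒜 n) (_ : b ∉ P) (a : A),
      T.toPolynomial b * y = T.toPolynomial a := by
  induction y using Polynomial.induction_on with
  | C r =>
    obtain ⟨n, a, b, ha, hb, hbP, rfl⟩ := exists_eq_homFrac r
    refine ⟨n, b, hb, hbP, a, ?_⟩
    rw [T.toPolynomial_of_mem ha, T.toPolynomial_of_mem hb, Polynomial.monomial_mul_C]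
    congr 1
    rw [divPow, homFrac_mul]
    exact homFrac_eq _ _ _ _ _ _ (by ring)
  | add p q hp hq =>
    obtain ⟨n, b, hb, hbP, a, h⟩ := hp
    obtain ⟨l, d, hd, hdP, c, h'⟩ := hq
    refine ⟨n + l, b * d, SetLike.mul_mem_graded hb hd, notMem_mul hbP hdP, d * a + b * c, ?_⟩
    rw [map_add, map_mul, map_mul, map_mul, ← h, ← h']
    ring
  | monomial i r h =>
    obtain ⟨n, b, hb, hbP, a, h⟩ := h
    refine ⟨n + T.deg, b * T.den, SetLike.mul_mem_graded hb T.den_mem,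
      notMem_mul hbP T.den_notMem, a * T.num, ?_⟩
    -- The variable itself is a fraction of images, namely that of `T = num / den`.
    have hX : T.toPolynomial T.den * Polynomial.X = T.toPolynomial T.num := by
      rw [T.toPolynomial_of_mem T.den_mem, T.toPolynomial_of_mem T.num_mem,
        Polynomial.monomial_mul_X]
      congr 1
      exact homFrac_eq _ _ _ _ _ _ (by ring)
    rw [map_mul, map_mul, ← h, ← hX]
    ring

/-! ### The local ring of `A` at the point `T = 1` over `P` -/

variable (𝒜 P) in
/-- The prime ideal of polynomials whose constant coefficient is not a unit. -/
noncomputable def originIdeal : Ideal (HomogeneousLocalization.AtPrime 𝒜 P)[X] :=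
  (IsLocalRing.maximalIdeal (HomogeneousLocalization.AtPrime 𝒜 P)).comap
    Polynomial.constantCoeff

instance : (originIdeal 𝒜 P).IsPrime := by
  unfold originIdeal
  infer_instance

theorem mem_originIdeal {p : (HomogeneousLocalization.AtPrime 𝒜 P)[X]} :
    p ∈ originIdeal 𝒜 P ↔ ¬ IsUnit (p.coeff 0) := by
  rw [originIdeal, Ideal.mem_comap, IsLocalRing.mem_maximalIdeal, mem_nonunits_iff,
    Polynomial.constantCoeff_apply]

/-- The homomorphism `∑ aₙ ↦ ∑ (aₙ / Tⁿ) (X + 1)ⁿ`. -/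
noncomputable def toPolynomialShift : A →+* (HomogeneousLocalization.AtPrime 𝒜 P)[X] :=
  (Polynomial.taylorEquiv (1 : HomogeneousLocalization.AtPrime 𝒜 P)).toRingEquiv.toRingHom.comp
    T.toPolynomial

theorem toPolynomialShift_apply (a : A) :
    T.toPolynomialShift a = Polynomial.taylor 1 (T.toPolynomial a) := rfl

/-- The prime of `A` under the origin, for the shifted homomorphism. -/
noncomputable def shiftPrime : Ideal A := (originIdeal 𝒜 P).comap T.toPolynomialShift

instance : T.shiftPrime.IsPrime := by
  unfold shiftPrime
  infer_instance

theorem shiftPrime_def : T.shiftPrime = (originIdeal 𝒜 P).comap T.toPolynomialShift := rfl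

/-- This is the purpose of the shift: the constant coefficient of `(b / Tⁿ)(X + 1)ⁿ` is the unit `b
/ Tⁿ`, whereas without the shift it would vanish for `n > 0`. In particular `T.num`, of positive
degree, separates `shiftPrime` from the vertex ideal. -/
theorem notMem_shiftPrime {n : ℕ} {b : A} (hb : b ∈ 𝒜 n) (hbP : b ∉ P) : b ∉ T.shiftPrime := by
  rw [shiftPrime, Ideal.mem_comap, mem_originIdeal, not_not, toPolynomialShift_apply,
    T.toPolynomial_of_mem hb, Polynomial.taylor_monomial]
  simpa [Polynomial.coeff_zero_eq_eval_zero] using T.isUnit_divPow hb hbP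

theorem exists_toPolynomialShift_mul (y : (HomogeneousLocalization.AtPrime 𝒜 P)[X]) :
    ∃ (b : A) (_ : b ∉ T.shiftPrime) (a : A),
      T.toPolynomialShift b * y = T.toPolynomialShift a := by
  obtain ⟨y, rfl⟩ :=
    (Polynomial.taylorEquiv (1 : HomogeneousLocalization.AtPrime 𝒜 P)).surjective y
  obtain ⟨n, b, hb, hbP, a, h⟩ := T.exists_toPolynomial_mul y
  refine ⟨b, T.notMem_shiftPrime hb hbP, a, ?_⟩
  rw [toPolynomialShift_apply, toPolynomialShift_apply, ← h, Polynomial.taylor_mul]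
  rfl

theorem toPolynomialShift_injective [IsDomain A] : Function.Injective T.toPolynomialShift :=
  (Polynomial.taylor_injective _).comp T.toPolynomial_injective

/-- The map `toPolynomialShift` is injective into a domain, and every polynomial is a fraction of
its values with denominator outside the prime. So nothing is lost or gained after localizing. -/
theorem localRingHom_bijective [IsDomain A] : Function.Bijective
    (Localization.localRingHom T.shiftPrime (originIdeal 𝒜 P) T.toPolynomialShift
      T.shiftPrime_def) := by
  constructor
  · rw [injective_iff_map_eq_zero]
    intro x hx
    obtain ⟨a, s, rfl⟩ := IsLocalization.exists_mk'_eq T.shiftPrime.primeCompl x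
    rw [Localization.localRingHom_mk', IsLocalization.mk'_eq_zero_iff] at hx
    obtain ⟨⟨c, hc⟩, h⟩ := hx
    have hc0 : c ≠ 0 := by
      rintro rfl
      exact hc (zero_mem _)
    have h0 := (mul_eq_zero.mp h).resolve_left hc0
    rw [T.toPolynomialShift_injective (h0.trans (map_zero _).symm), IsLocalization.mk'_zero]
  · intro x
    obtain ⟨y, ⟨s, hs⟩, rfl⟩ := IsLocalization.exists_mk'_eq (originIdeal 𝒜 P).primeCompl x
    obtain ⟨b, hb, a, h⟩ := T.exists_toPolynomialShift_mul y
    obtain ⟨d, hd, c, h'⟩ := T.exists_toPolynomialShift_mul s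
    have hc : c ∉ T.shiftPrime := fun hc => notMem_mul (show _ ∉ originIdeal 𝒜 P from hd) hs
      (by rw [h']; exact hc)
    -- With `y = a / b` and `s = c / d`, the quotient `y / s` is `ad / bc`; here `c` is an allowed
    -- denominator because its image is that of `d` times `s`.
    refine ⟨IsLocalization.mk' _ (a * d)
      (⟨b * c, notMem_mul hb hc⟩ : T.shiftPrime.primeCompl), ?_⟩
    rw [Localization.localRingHom_mk']
    refine IsLocalization.mk'_eq_of_eq ?_
    simp only [map_mul]
    rw [← h, ← h']
    ring

end DegreeOneUnit

end HomogeneousFraction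

/-! ### Polynomials in an element killed by a retraction -/

section Retraction

variable {R L : Type*} [CommRing R] [CommRing L] {ρ : R →+* L} {σ : L →+* R} {t : L}

theorem retraction_eval₂ (h : ∀ x, σ (ρ x) = x) (ht : σ t = 0) (p : R[X]) :
    σ (p.eval₂ ρ t) = p.coeff 0 := by
  rw [Polynomial.hom_eval₂, ht, show σ.comp ρ = RingHom.id _ from RingHom.ext h,
    Polynomial.eval₂_id, Polynomial.coeff_zero_eq_eval_zero]

/-- A nonzero element of a domain `L` which maps to zero under a retraction `L → R` is
transcendental over `R`. -/
theorem eval₂RingHom_injective [IsDomain L] (h : ∀ x, σ (ρ x) = x) (ht : σ t = 0)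
    (ht0 : t ≠ 0) : Function.Injective (Polynomial.eval₂RingHom ρ t) := by
  rw [injective_iff_map_eq_zero]
  suffices ∀ (n : ℕ) (p : R[X]), p.natDegree ≤ n → p.eval₂ ρ t = 0 → p = 0 from
    fun p => this _ p le_rfl
  intro n
  induction n with
  | zero =>
    intro p hp hp0
    have h0 := retraction_eval₂ h ht p
    rw [hp0, map_zero] at h0
    rw [Polynomial.eq_C_of_natDegree_le_zero hp, ← h0, map_zero]
  | succ n ih =>
    intro p hp hp0
    have h0 := retraction_eval₂ h ht p
    rw [hp0, map_zero] at h0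
    -- The retraction shows that the constant coefficient vanishes; cancelling `t` in the domain `L`
    -- lowers the degree.
    have hp' : p = p.divX * Polynomial.X := by
      conv_lhs => rw [← Polynomial.divX_mul_X_add p, ← h0, map_zero, add_zero]
    rw [hp', Polynomial.eval₂_mul, Polynomial.eval₂_X] at hp0
    rw [hp', ih p.divX (by rw [Polynomial.natDegree_divX_eq_natDegree_tsub_one]; omega)
      ((mul_eq_zero.mp hp0).resolve_right ht0), zero_mul]

end Retraction

/-! ### Functoriality of degree zero fractions -/

section HomogeneousFractionMap

variable {A σ : Type*} [CommRing A] [SetLike σ A] [AddSubgroupClass σ A] {𝒜 : ℕ → σ}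
  [GradedRing 𝒜] {P : Ideal A} [P.IsPrime]
  {B τ : Type*} [CommRing B] [SetLike τ B] [AddSubgroupClass τ B] {ℬ : ℕ → τ}
  [GradedRing ℬ] {Q : Ideal B} [Q.IsPrime]

theorem homFrac_pow {n : ℕ} {a b : A} (ha : a ∈ 𝒜 n) (hb : b ∈ 𝒜 n) (hbP : b ∉ P) (j : ℕ) :
    homFrac 𝒜 P a b ha hb hbP ^ j =
      homFrac 𝒜 P (a ^ j) (b ^ j) (SetLike.pow_mem_graded j ha)
        (SetLike.pow_mem_graded j hb) (notMem_pow hbP j) := by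
  apply HomogeneousLocalization.val_injective
  rw [HomogeneousLocalization.val_pow, homFrac_val, homFrac_val, Localization.mk_pow]
  rfl

theorem localRingHom_homFrac (φ : 𝒜 →+*ᵍ ℬ) (h : P = Q.comap φ) {n : ℕ} {a b : A}
    (ha : a ∈ 𝒜 n) (hb : b ∈ 𝒜 n) (hbP : b ∉ P) (hbQ : φ b ∉ Q) :
    HomogeneousLocalization.localRingHom φ P Q h (homFrac 𝒜 P a b ha hb hbP) =
      homFrac ℬ Q (φ a) (φ b) (φ.map_mem ha) (φ.map_mem hb) hbQ := rfl

end HomogeneousFractionMap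

/-! ### The Rees algebra and its local ring at the generic point of `E ∩ Z'` -/

section Rees

variable {A : Type u} [CommRing A] [Algebra ℂ A] {𝒜 : ℕ → Submodule ℂ A} [GradedAlgebra 𝒜]

theorem mem_weightIdeal_of_mem {n k : ℕ} (hnk : n ≤ k) {a : A} (ha : a ∈ 𝒜 k) :
    a ∈ weightIdeal 𝒜 n := fun l hl =>
  DirectSum.decompose_of_mem_ne 𝒜 ha (by omega)

/-- The leading components of elements of the weight ideals are multiplicative. -/
theorem decompose_mul_of_mem_weightIdeal {n l : ℕ} {a b : A} (ha : a ∈ weightIdeal 𝒜 n)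
    (hb : b ∈ weightIdeal 𝒜 l) : (DirectSum.decompose 𝒜 (a * b) (n + l) : A) =
      DirectSum.decompose 𝒜 a n * DirectSum.decompose 𝒜 b l := by
  classical
  rw [DirectSum.decompose_mul, DirectSum.coe_mul_apply]
  rw [Finset.sum_eq_single (n, l)]
  · rintro ⟨i, j⟩ hij hne
    have hsum : i + j = n + l := (Finset.mem_filter.mp hij).2
    rcases lt_or_ge i n with h | h
    · simp only [ha i h, zero_mul]
    · have : j < l := by
        rcases Nat.lt_or_ge j l with h' | h'
        · exact h'
        · exact absurd (Prod.ext (by simp; omega) (by simp; omega)) hne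
      simp only [hb j this, mul_zero]
  · intro h
    by_contra hne
    apply h
    simp only [Finset.mem_filter, Finset.mem_product, DFinsupp.mem_support_iff, and_true]
    constructor
    · intro h0
      simp [h0] at hne
    · intro h0
      simp [h0] at hne

/-- The element `a uⁿ` of the Rees algebra. -/
noncomputable def reesMonomial (n : ℕ) (a : A) (ha : a ∈ weightIdeal 𝒜 n) : rees 𝒜 :=
  ⟨Polynomial.monomial n a, fun k => by
    rw [Polynomial.coeff_monomial]
    split_ifs with h
    · exact h ▸ ha
    · exact Ideal.zero_mem _⟩

theorem coe_reesMonomial {n : ℕ} {a : A} (ha : a ∈ weightIdeal 𝒜 n) :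
    (reesMonomial n a ha : A[X]) = Polynomial.monomial n a := rfl

theorem reesMonomial_mem {n : ℕ} {a : A} (ha : a ∈ weightIdeal 𝒜 n) :
    reesMonomial n a ha ∈ reesGrading 𝒜 n := fun _ hk =>
  Polynomial.coeff_monomial_of_ne _ hk

theorem eq_reesMonomial {n : ℕ} {p : rees 𝒜} (hp : p ∈ reesGrading 𝒜 n) :
    p = reesMonomial n ((p : A[X]).coeff n) (p.2 n) := by
  apply Subtype.ext
  ext k
  rw [coe_reesMonomial, Polynomial.coeff_monomial]
  split_ifs with h
  · rw [h]
  · exact hp k (Ne.symm h)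

theorem reesMonomial_add {n : ℕ} {a b : A} (ha : a ∈ weightIdeal 𝒜 n)
    (hb : b ∈ weightIdeal 𝒜 n) : reesMonomial n (a + b) (add_mem ha hb) =
      reesMonomial n a ha + reesMonomial n b hb :=
  Subtype.ext (map_add (Polynomial.monomial n) a b)

variable (𝒜) in
/-- The underlying ring homomorphism of `toRees`. -/
noncomputable def toReesHom : A →+* rees 𝒜 :=
  gradedLift (𝒜 := 𝒜)
    (fun n => AddMonoidHom.mk'
      (fun a => reesMonomial n a.1 (mem_weightIdeal_of_mem le_rfl a.2))
      (fun a b => reesMonomial_add _ _))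
    (Subtype.ext (by exact Polynomial.monomial_zero_one))
    (fun i j a b => Subtype.ext (by
      exact (Polynomial.monomial_mul_monomial i j a.1 b.1).symm))

variable (𝒜) in
/-- The homomorphism `∑ aₙ ↦ ∑ aₙ uⁿ` to the Rees algebra. -/
noncomputable def toRees : 𝒜 →+*ᵍ reesGrading 𝒜 where
  __ := toReesHom 𝒜
  map_mem := fun {n a} ha => by
    rw [toReesHom, gradedLift_of_mem (ha := ha)]
    exact reesMonomial_mem (mem_weightIdeal_of_mem le_rfl ha)

theorem toRees_of_mem {n : ℕ} {a : A} (ha : a ∈ 𝒜 n) :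
    toRees 𝒜 a = reesMonomial n a (mem_weightIdeal_of_mem le_rfl ha) := by
  change toReesHom 𝒜 a = _
  rw [toReesHom, gradedLift_of_mem (ha := ha)]
  rfl

theorem coeff_mul_of_mem {i j : ℕ} {p q : rees 𝒜} (hp : p ∈ reesGrading 𝒜 i)
    (hq : q ∈ reesGrading 𝒜 j) : ((p * q : rees 𝒜) : A[X]).coeff (i + j) =
      (p : A[X]).coeff i * (q : A[X]).coeff j := by
  conv_lhs => rw [eq_reesMonomial hp, eq_reesMonomial hq]
  rw [MulMemClass.coe_mul, coe_reesMonomial, coe_reesMonomial,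
    Polynomial.monomial_mul_monomial, Polynomial.coeff_monomial_same]

variable (𝒜) in
/-- The underlying ring homomorphism of `leading`. -/
noncomputable def leadingHom : rees 𝒜 →+* A :=
  gradedLift (𝒜 := reesGrading 𝒜)
    (fun n => AddMonoidHom.mk'
      (fun p => (DirectSum.decompose 𝒜 ((p.1 : A[X]).coeff n) n : A))
      (fun p q => by simp))
    (by
      change (DirectSum.decompose 𝒜 ((1 : A[X]).coeff 0) 0 : A) = 1
      rw [Polynomial.coeff_one_zero,
        DirectSum.decompose_of_mem_same 𝒜 SetLike.GradedOne.one_mem])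
    (fun i j p q => by
      simp only [AddMonoidHom.mk'_apply]
      rw [coeff_mul_of_mem p.2 q.2, decompose_mul_of_mem_weightIdeal (p.1.2 i) (q.1.2 j)])

variable (𝒜) in
/-- The homomorphism from the Rees algebra to the associated graded ring, which is `A` again:
it maps `∑ aₛ uˢ` to the sum of the components of degree `s` of the `aₛ`. -/
noncomputable def leading : reesGrading 𝒜 →+*ᵍ 𝒜 where
  __ := leadingHom 𝒜
  map_mem := fun {n a} ha => by
    rw [leadingHom, gradedLift_of_mem (ha := ha)]
    exact SetLike.coe_mem _

theorem leading_of_mem {n : ℕ} {p : rees 𝒜} (hp : p ∈ reesGrading 𝒜 n) :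
    leading 𝒜 p = (DirectSum.decompose 𝒜 ((p : A[X]).coeff n) n : A) := by
  change leadingHom 𝒜 p = _
  rw [leadingHom, gradedLift_of_mem (ha := hp)]
  rfl

theorem leading_reesMonomial {n : ℕ} {a : A} (ha : a ∈ weightIdeal 𝒜 n) :
    leading 𝒜 (reesMonomial n a ha) = DirectSum.decompose 𝒜 a n := by
  rw [leading_of_mem (reesMonomial_mem ha), coe_reesMonomial, Polynomial.coeff_monomial_same]

theorem leading_toRees (a : A) : leading 𝒜 (toRees 𝒜 a) = a := by
  induction a using DirectSum.Decomposition.inductionOn 𝒜 with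
  | zero => simp
  | @homogeneous i a =>
    rw [toRees_of_mem a.2, leading_reesMonomial, DirectSum.decompose_of_mem_same 𝒜 a.2]
  | add a b ha hb => rw [map_add, map_add, ha, hb]

variable (P : Ideal A) [P.IsPrime]

/-- The prime of the Rees algebra of elements whose leading components lie in `P`. -/
noncomputable def leadingPrime : Ideal (rees 𝒜) := P.comap (leading 𝒜)

instance : (leadingPrime (𝒜 := 𝒜) P).IsPrime := by
  unfold leadingPrime
  infer_instance

theorem leadingPrime_def : leadingPrime (𝒜 := 𝒜) P = P.comap (leading 𝒜) := rfl

theorem eq_comap_toRees_leadingPrime : P = (leadingPrime (𝒜 := 𝒜) P).comap (toRees 𝒜) := by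
  ext a
  rw [leadingPrime, Ideal.mem_comap, Ideal.mem_comap, leading_toRees]

variable {P}

theorem reesMonomial_mem_leadingPrime {n : ℕ} {a : A} (ha : a ∈ weightIdeal 𝒜 n) :
    reesMonomial n a ha ∈ leadingPrime P ↔ (DirectSum.decompose 𝒜 a n : A) ∈ P := by
  rw [leadingPrime, Ideal.mem_comap, leading_reesMonomial]

theorem reesMonomial_notMem_leadingPrime {n : ℕ} {a : A} (ha : a ∈ 𝒜 n) (haP : a ∉ P)
    (ha' : a ∈ weightIdeal 𝒜 n) : reesMonomial n a ha' ∉ leadingPrime P := by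
  rwa [reesMonomial_mem_leadingPrime, DirectSum.decompose_of_mem_same 𝒜 ha]

variable (𝒜 P) in
/-- The degree zero part of the localization of the Rees algebra at `leadingPrime P`. -/
abbrev ReesLocal := HomogeneousLocalization.AtPrime (reesGrading 𝒜) (leadingPrime (𝒜 := 𝒜) P)

variable (𝒜 P) in
/-- The restriction of `ReesLocal` to the leading components. -/
noncomputable def leadingLocal : ReesLocal 𝒜 P →+* HomogeneousLocalization.AtPrime 𝒜 P :=
  HomogeneousLocalization.localRingHom (leading 𝒜) (leadingPrime P) P (leadingPrime_def P)

variable (𝒜 P) in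
/-- The homomorphism of degree zero localizations induced by `toRees`. -/
noncomputable def toReesLocal : HomogeneousLocalization.AtPrime 𝒜 P →+* ReesLocal 𝒜 P :=
  HomogeneousLocalization.localRingHom (toRees 𝒜) P (leadingPrime P)
    (eq_comap_toRees_leadingPrime P)

instance : IsLocalHom (leadingLocal 𝒜 P) := by
  unfold leadingLocal
  infer_instance

/-- The identity `leading_toRees` passes to fractions. It makes `ReesLocal` retract onto the degree
zero localization, as `eval₂RingHom_injective` requires. -/
theorem leadingLocal_toReesLocal (x : HomogeneousLocalization.AtPrime 𝒜 P) :
    leadingLocal 𝒜 P (toReesLocal 𝒜 P x) = x := by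
  obtain ⟨n, a, b, ha, hb, hbP, rfl⟩ := exists_eq_homFrac x
  have h1 : toRees 𝒜 b ∉ leadingPrime P := by
    rw [toRees_of_mem hb]
    exact reesMonomial_notMem_leadingPrime hb hbP _
  have h2 : leading 𝒜 (toRees 𝒜 b) ∉ P := by rwa [leading_toRees]
  rw [toReesLocal, localRingHom_homFrac _ _ ha hb hbP h1, leadingLocal,
    localRingHom_homFrac _ _ _ _ h1 h2]
  exact homFrac_eq _ _ _ _ _ _ (by rw [leading_toRees, leading_toRees])

namespace DegreeOneUnit

variable (T : DegreeOneUnit 𝒜 P)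

theorem reesMonomial_den_notMem : reesMonomial T.deg T.den
    (mem_weightIdeal_of_mem le_rfl T.den_mem) ∉ leadingPrime P :=
  reesMonomial_notMem_leadingPrime T.den_mem T.den_notMem _

/-- The local equation `T = num / den` of the exceptional divisor. -/
noncomputable def parameter : ReesLocal 𝒜 P :=
  homFrac (reesGrading 𝒜) (leadingPrime P)
    (reesMonomial T.deg T.num (mem_weightIdeal_of_mem (Nat.le_succ _) T.num_mem))
    (reesMonomial T.deg T.den (mem_weightIdeal_of_mem le_rfl T.den_mem))
    (reesMonomial_mem _) (reesMonomial_mem _) T.reesMonomial_den_notMem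

/-- The numerator has degree `T.deg + 1` but sits in degree `T.deg` of the Rees algebra, so its
leading component is zero. -/
theorem leadingLocal_parameter : leadingLocal 𝒜 P T.parameter = 0 := by
  have h : leading 𝒜 (reesMonomial T.deg T.den
      (mem_weightIdeal_of_mem le_rfl T.den_mem)) ∉ P := T.reesMonomial_den_notMem
  rw [leadingLocal, parameter, localRingHom_homFrac _ _ _ _ _ h,
    ← homFrac_zero ((leading 𝒜).map_mem (reesMonomial_mem _)) h]
  refine homFrac_eq _ _ _ _ _ _ ?_
  rw [leading_reesMonomial, DirectSum.decompose_of_mem_ne 𝒜 T.num_mem (Nat.succ_ne_self _),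
    zero_mul, zero_mul]

theorem parameter_ne_zero [IsDomain A] : T.parameter ≠ 0 := by
  rw [parameter, Ne, homFrac_eq_zero_iff, ← Subtype.coe_inj, coe_reesMonomial,
    ZeroMemClass.coe_zero, Polynomial.monomial_eq_zero_iff]
  intro h
  exact T.num_notMem (h ▸ P.zero_mem)

/-- The homomorphism `X ↦ T` from polynomials over the degree zero localization at `P`. -/
noncomputable def ofPolynomial :
    (HomogeneousLocalization.AtPrime 𝒜 P)[X] →+* ReesLocal 𝒜 P :=
  Polynomial.eval₂RingHom (toReesLocal 𝒜 P) T.parameter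

theorem leadingLocal_ofPolynomial (p : (HomogeneousLocalization.AtPrime 𝒜 P)[X]) :
    leadingLocal 𝒜 P (T.ofPolynomial p) = p.coeff 0 :=
  retraction_eval₂ leadingLocal_toReesLocal T.leadingLocal_parameter p

theorem ofPolynomial_injective [IsDomain A] : Function.Injective T.ofPolynomial :=
  eval₂RingHom_injective leadingLocal_toReesLocal T.leadingLocal_parameter T.parameter_ne_zero

/-- The map `leadingLocal` is local and sends the value of `p` to its constant coefficient, which
therefore decides invertibility. -/
theorem isUnit_ofPolynomial_iff (p : (HomogeneousLocalization.AtPrime 𝒜 P)[X]) :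
    IsUnit (T.ofPolynomial p) ↔ p ∉ originIdeal 𝒜 P := by
  rw [mem_originIdeal, not_not, ← T.leadingLocal_ofPolynomial, isUnit_map_iff (leadingLocal 𝒜 P)]

/-- Fractions whose denominator has a homogeneous coefficient come from polynomials. -/
theorem exists_ofPolynomial_eq {n : ℕ} {a g : A} (ha : a ∈ weightIdeal 𝒜 n) (hg : g ∈ 𝒜 n)
    (hgP : g ∉ P) : ∃ p, T.ofPolynomial p = homFrac (reesGrading 𝒜) (leadingPrime P)
      (reesMonomial n a ha) (reesMonomial n g (mem_weightIdeal_of_mem le_rfl hg))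
      (reesMonomial_mem _) (reesMonomial_mem _)
      (reesMonomial_notMem_leadingPrime hg hgP _) := by
  classical
  -- The fraction depends on a proof of membership in the weight ideal, so the predicate carries
  -- that proof through the sum over homogeneous components.
  let S : A → Prop := fun a => ∃ (h : a ∈ weightIdeal 𝒜 n) (p : _), T.ofPolynomial p =
    homFrac (reesGrading 𝒜) (leadingPrime P)
      (reesMonomial n a h) (reesMonomial n g (mem_weightIdeal_of_mem le_rfl hg))
      (reesMonomial_mem _) (reesMonomial_mem _) (reesMonomial_notMem_leadingPrime hg hgP _)
  suffices S a from this.2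
  rw [← DirectSum.sum_support_decompose 𝒜 a]
  refine Finset.sum_induction _ S ?_ ?_ ?_
  · rintro x y ⟨hx, p, hp⟩ ⟨hy, q, hq⟩
    refine ⟨add_mem hx hy, p + q, ?_⟩
    rw [map_add, hp, hq, ← homFrac_add]
    exact homFrac_eq _ _ _ _ _ _ (by rw [reesMonomial_add])
  · refine ⟨zero_mem _, 0, ?_⟩
    rw [map_zero, ← homFrac_zero (𝒜 := reesGrading 𝒜)
      (reesMonomial_mem (mem_weightIdeal_of_mem le_rfl hg))
      (reesMonomial_notMem_leadingPrime hg hgP _)]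
    exact homFrac_eq _ _ _ _ _ _ (by
      congr 1
      exact Subtype.ext (map_zero _).symm)
  · intro k hk
    have hnk : n ≤ k := by
      by_contra h
      exact DFinsupp.mem_support_iff.mp hk (Subtype.ext (ha k (not_le.mp h)))
    obtain ⟨j, rfl⟩ := Nat.exists_eq_add_of_le hnk
    generalize (DirectSum.decompose 𝒜 a (n + j) : 𝒜 (n + j)) = c
    obtain ⟨c, hc⟩ := c
    refine ⟨mem_weightIdeal_of_mem hnk hc, ?_⟩
    have h1 : c * T.den ^ j ∈ 𝒜 (n + j * (T.deg + 1)) := by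
      have := SetLike.mul_mem_graded hc (SetLike.pow_mem_graded j T.den_mem)
      rwa [smul_eq_mul, show n + j + j * T.deg = n + j * (T.deg + 1) by ring] at this
    have h2 : g * T.num ^ j ∈ 𝒜 (n + j * (T.deg + 1)) :=
      SetLike.mul_mem_graded hg (SetLike.pow_mem_graded j T.num_mem)
    have h3 : g * T.num ^ j ∉ P := notMem_mul hgP (notMem_pow T.num_notMem j)
    -- For `c` of degree `n + j` the quotient `c / g` has degree `j`, so it equals the degree zero
    -- fraction `c / (g Tʲ)` times `Tʲ`.
    refine ⟨Polynomial.C (homFrac 𝒜 P _ _ h1 h2 h3) * Polynomial.X ^ j, ?_⟩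
    have h4 : toRees 𝒜 (g * T.num ^ j) ∉ leadingPrime P := by
      rw [toRees_of_mem h2]
      exact reesMonomial_notMem_leadingPrime h2 h3 _
    rw [ofPolynomial, Polynomial.coe_eval₂RingHom, Polynomial.eval₂_mul, Polynomial.eval₂_C,
      Polynomial.eval₂_X_pow, toReesLocal, localRingHom_homFrac _ _ h1 h2 h3 h4, parameter,
      homFrac_pow, homFrac_mul]
    refine homFrac_eq _ _ _ _ _ _ (Subtype.ext ?_)
    rw [toRees_of_mem h1, toRees_of_mem h2]
    simp only [MulMemClass.coe_mul, SubmonoidClass.coe_pow, coe_reesMonomial,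
      Polynomial.monomial_pow, Polynomial.monomial_mul_monomial]
    congr 1
    · congr 1
      ring
    · ring

/-- The degree zero localization of the Rees algebra is a localization of a polynomial ring. -/
noncomputable def ofLocalization :
    Localization.AtPrime (originIdeal 𝒜 P) →+* ReesLocal 𝒜 P :=
  IsLocalization.lift (M := (originIdeal 𝒜 P).primeCompl) (g := T.ofPolynomial)
    fun p => (T.isUnit_ofPolynomial_iff p).mpr p.2

theorem ofLocalization_bijective [IsDomain A] : Function.Bijective T.ofLocalization := by
  constructor
  · refine (IsLocalization.lift_injective_iff _).mpr fun x y => ⟨fun h => ?_, fun h => ?_⟩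
    · rw [IsLocalization.eq_iff_exists (originIdeal 𝒜 P).primeCompl] at h
      obtain ⟨c, hc⟩ := h
      have hc0 : (c : (HomogeneousLocalization.AtPrime 𝒜 P)[X]) ≠ 0 := fun h0 =>
        c.2 (h0 ▸ zero_mem _)
      rw [mul_left_cancel₀ hc0 hc]
    · rw [T.ofPolynomial_injective h]
  · intro x
    obtain ⟨n, a, b, ha, hb, hbP, rfl⟩ := exists_eq_homFrac x
    -- Let `g` be the leading component of the denominator. Then `a / b` is the quotient of `a / g`
    -- by `b / g`, both of which come from polynomials, and `b / g` is a unit.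
    have hg : (DirectSum.decompose 𝒜 ((b : A[X]).coeff n) n : A) ∉ P := by
      rwa [eq_reesMonomial hb, reesMonomial_mem_leadingPrime] at hbP
    obtain ⟨p, hp⟩ := T.exists_ofPolynomial_eq (a.2 n) (SetLike.coe_mem _) hg
    obtain ⟨q, hq⟩ := T.exists_ofPolynomial_eq (b.2 n) (SetLike.coe_mem _) hg
    have hqu : q ∉ originIdeal 𝒜 P := by
      rw [← T.isUnit_ofPolynomial_iff, hq, isUnit_homFrac_iff, ← eq_reesMonomial hb]
      exact hbP
    refine ⟨IsLocalization.mk' _ p (⟨q, hqu⟩ : (originIdeal 𝒜 P).primeCompl), ?_⟩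
    rw [ofLocalization, IsLocalization.lift_mk'_spec, hp, hq, homFrac_mul]
    refine homFrac_eq _ _ _ _ _ _ ?_
    rw [← eq_reesMonomial hb, ← eq_reesMonomial ha]
    ring

end DegreeOneUnit

end Rees

/-! ### Points of the weighted blow-up: exceptional fibre, proper transform, regularity -/

section Geometry

/-- The image of a point under `Proj 𝒜 ⟶ Spec (𝒜 0)`. -/
theorem mem_asIdeal_toSpecZero {B σ : Type u} [CommRing B] [SetLike σ B] [AddSubgroupClass σ B]
    (ℬ : ℕ → σ) [GradedRing ℬ] (x : Proj ℬ) (b : ℬ 0) :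
    b ∈ (Proj.toSpecZero ℬ x).asIdeal ↔ (b : B) ∈ x.asHomogeneousIdeal := by
  classical
  obtain ⟨f, n, hn, hf, hfx⟩ : ∃ (f : B) (n : ℕ), 0 < n ∧ f ∈ ℬ n ∧
      f ∉ x.asHomogeneousIdeal := by
    by_contra! h
    exact x.not_irrelevant_le ((HomogeneousIdeal.toIdeal_irrelevant_le ℬ).mpr
      fun n hn f hf => h f n hn hf)
  have hx : x ∈ (Proj.awayι ℬ f hf hn).opensRange := by
    rw [Proj.opensRange_awayι]
    exact hfx
  obtain ⟨y, rfl⟩ := hx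
  -- The description of basic opens on a chart needs positive degree, so `b` is replaced by `f * b`.
  -- This does not affect membership in the prime because `f` lies outside it.
  have hfb : f * b ∈ ℬ n := by simpa using SetLike.mul_mem_graded hf b.2
  have h1 : Proj.awayι ℬ f hf hn y ∈ Proj.basicOpen ℬ (f * b) ↔
      HomogeneousLocalization.Away.isLocalizationElem hf hfb ∉ y.asIdeal := by
    exact iff_of_eq (congrArg (y ∈ ·) (Proj.awayι_preimage_basicOpen ℬ hf hn hfb hn))
  have h2 : HomogeneousLocalization.Away.isLocalizationElem hf hfb =
      HomogeneousLocalization.fromZeroRingHom ℬ (Submonoid.powers f) b ^ n := by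
    apply HomogeneousLocalization.val_injective
    rw [HomogeneousLocalization.val_pow]
    change Localization.mk ((f * (b : B)) ^ n) _ = Localization.mk (b : B) 1 ^ n
    rw [Localization.mk_pow, Localization.mk_eq_mk_iff, Localization.r_iff_exists]
    exact ⟨1, by simp [mul_pow]⟩
  have h3 : Proj.toSpecZero ℬ (Proj.awayι ℬ f hf hn y) =
      PrimeSpectrum.comap (HomogeneousLocalization.fromZeroRingHom ℬ (Submonoid.powers f)) y := by
    rw [← Scheme.Hom.comp_apply, Proj.awayι_toSpecZero]
    rfl
  rw [h2, Ideal.IsPrime.pow_mem_iff_mem y.2 n hn] at h1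
  rw [h3]
  refine (not_iff_not.mp h1).symm.trans ?_
  change f * (b : B) ∈ (Proj.awayι ℬ f hf hn y).asHomogeneousIdeal.toIdeal ↔ _
  rw [Ideal.IsPrime.mul_mem_iff_mem_or_mem (Proj.awayι ℬ f hf hn y).isPrime]
  exact or_iff_right hfx

variable {A : Type u} [CommRing A] [Algebra ℂ A] {𝒜 : ℕ → Submodule ℂ A} [GradedAlgebra 𝒜]

/-- The image of a point under the weighted blow-up morphism. -/
theorem mem_asIdeal_toBase (x : Proj (reesGrading 𝒜)) (a : A) :
    a ∈ (toBase 𝒜 x).asIdeal ↔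
      algebraMap A (rees 𝒜) a ∈ x.asHomogeneousIdeal := by
  exact mem_asIdeal_toSpecZero (reesGrading 𝒜) x (algebraMap A (reesGrading 𝒜 0) a)

theorem coeff_decompose_rees (p : rees 𝒜) (n k : ℕ) :
    ((DirectSum.decompose (reesGrading 𝒜) p n : rees 𝒜) : A[X]).coeff k =
      if k = n then (p : A[X]).coeff n else 0 := by
  split_ifs with h
  · subst h
    have := coeff_coeAddMonoidHom 𝒜 (DirectSum.decompose (reesGrading 𝒜) p) k
    rw [← this]
    congr 2
    exact (DirectSum.Decomposition.left_inv p)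
  · exact (DirectSum.decompose (reesGrading 𝒜) p n).2 k h

variable (P : Ideal A) [P.IsPrime]

theorem leadingPrime_isHomogeneous (hP : P.IsHomogeneous 𝒜) :
    (leadingPrime P).IsHomogeneous (reesGrading 𝒜) := by
  intro n p hp
  rw [leadingPrime, Ideal.mem_comap, GradedRingHom.map_directSumDecompose]
  exact hP n hp

variable (𝒜) in
/-- The prime of the Rees algebra of elements whose coefficients lie in `P`. -/
noncomputable def coeffPrime : Ideal (rees 𝒜) :=
  (P.map Polynomial.C).comap (rees 𝒜).val.toRingHom

instance : (coeffPrime 𝒜 P).IsPrime := by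
  have := Ideal.isPrime_map_C_of_isPrime (P := P)
  unfold coeffPrime
  infer_instance

theorem mem_coeffPrime {p : rees 𝒜} : p ∈ coeffPrime 𝒜 P ↔ ∀ n, (p : A[X]).coeff n ∈ P :=
  Ideal.mem_map_C_iff

theorem coeffPrime_isHomogeneous : (coeffPrime 𝒜 P).IsHomogeneous (reesGrading 𝒜) := by
  intro n p hp
  rw [mem_coeffPrime] at hp ⊢
  intro k
  rw [coeff_decompose_rees]
  split_ifs
  · exact hp n
  · exact P.zero_mem

/-- Homogeneity of `P` keeps the leading component of a coefficient in `P`. Geometrically,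
`coeffPoint` specializes to `leadingPoint`. -/
theorem coeffPrime_le_leadingPrime (hP : P.IsHomogeneous 𝒜) :
    coeffPrime 𝒜 P ≤ leadingPrime (𝒜 := 𝒜) P := by
  classical
  intro p hp
  rw [mem_coeffPrime] at hp
  rw [leadingPrime, Ideal.mem_comap, ← DirectSum.sum_support_decompose (reesGrading 𝒜) p, map_sum]
  refine Ideal.sum_mem _ fun n _ => ?_
  rw [leading_of_mem (SetLike.coe_mem _), coeff_decompose_rees, if_pos rfl]
  exact hP n (hp n)

variable {P}

theorem reesMonomial_mem_irrelevant {n : ℕ} (hn : 0 < n) {a : A} (ha : a ∈ weightIdeal 𝒜 n) :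
    reesMonomial n a ha ∈ (HomogeneousIdeal.irrelevant (reesGrading 𝒜)).toIdeal :=
  HomogeneousIdeal.mem_irrelevant_of_mem _ hn (reesMonomial_mem ha)

/-- The generic point of `E ∩ Z'`, for `P` the ideal of `X'`. -/
noncomputable def leadingPoint (hP : P.IsHomogeneous 𝒜) {n : ℕ} (hn : 0 < n) {g : A}
    (hg : g ∈ 𝒜 n) (hgP : g ∉ P) : Proj (reesGrading 𝒜) where
  asHomogeneousIdeal := ⟨leadingPrime P, leadingPrime_isHomogeneous P hP⟩
  isPrime := inferInstanceAs (leadingPrime (𝒜 := 𝒜) P).IsPrime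
  not_irrelevant_le := fun h => reesMonomial_notMem_leadingPrime hg hgP
    (mem_weightIdeal_of_mem le_rfl hg) (h (reesMonomial_mem_irrelevant hn _))

/-- The generic point of `Z'`, for `P` the ideal of `X'`. -/
noncomputable def coeffPoint (hP : P.IsHomogeneous 𝒜) {n : ℕ} (hn : 0 < n) {g : A}
    (hg : g ∈ 𝒜 n) (hgP : g ∉ P) : Proj (reesGrading 𝒜) where
  asHomogeneousIdeal := ⟨coeffPrime 𝒜 P, coeffPrime_isHomogeneous P⟩
  isPrime := inferInstanceAs (coeffPrime 𝒜 P).IsPrime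
  not_irrelevant_le := fun h => reesMonomial_notMem_leadingPrime hg hgP
    (mem_weightIdeal_of_mem le_rfl hg)
    (coeffPrime_le_leadingPrime P hP (h (reesMonomial_mem_irrelevant hn _)))

variable (hP : P.IsHomogeneous 𝒜) {n : ℕ} (hn : 0 < n) {g : A} (hg : g ∈ 𝒜 n) (hgP : g ∉ P)

/-- An element of the vertex ideal, placed in degree zero of the Rees algebra, has zero leading
component. -/
theorem leadingPoint_mem_exceptionalSet :
    leadingPoint hP hn hg hgP ∈ exceptionalSet 𝒜 := by
  change (vertexIdeal 𝒜 : Set A) ⊆ (toBase 𝒜 _).asIdeal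
  intro a ha
  refine (mem_asIdeal_toBase _ a).mpr ?_
  change algebraMap A (rees 𝒜) a ∈ leadingPrime P
  have h : algebraMap A (rees 𝒜) a = reesMonomial 0 a (mem_weightIdeal_zero 𝒜 a) :=
    Subtype.ext (Polynomial.monomial_zero_left (a := a)).symm
  rw [h, reesMonomial_mem_leadingPrime, (mem_vertexIdeal 𝒜).mp ha]
  exact P.zero_mem

theorem asIdeal_toBase_coeffPoint :
    (toBase 𝒜 (coeffPoint hP hn hg hgP)).asIdeal = P := by
  ext a
  refine (mem_asIdeal_toBase _ a).trans ?_
  change algebraMap A (rees 𝒜) a ∈ coeffPrime 𝒜 P ↔ _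
  rw [mem_coeffPrime]
  change (∀ n, (Polynomial.C a).coeff n ∈ P) ↔ _
  simp only [Polynomial.coeff_C]
  refine ⟨fun h => by simpa using h 0, fun h k => ?_⟩
  split_ifs
  · exact h
  · exact P.zero_mem

/-- The point `coeffPoint` lies over `P`, which contains `f` but not `g` of positive degree, so it
lies over `X'` minus the vertex. Its closure contains `leadingPoint`. -/
theorem leadingPoint_mem_properTransform {f : A} (hf : f ∈ P) :
    leadingPoint hP hn hg hgP ∈ properTransform 𝒜 f := by
  refine closure_mono (Set.singleton_subset_iff.mpr ?_)
    ((ProjectiveSpectrum.le_iff_mem_closure (reesGrading 𝒜) (coeffPoint hP hn hg hgP)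
      (leadingPoint hP hn hg hgP)).mp (coeffPrime_le_leadingPrime P hP))
  have h2 := asIdeal_toBase_coeffPoint hP hn hg hgP
  constructor
  · change ({f} : Set A) ⊆ (toBase 𝒜 _).asIdeal
    rw [Set.singleton_subset_iff, SetLike.mem_coe]
    exact h2.symm ▸ hf
  · intro h
    have h3 : (vertexIdeal 𝒜 : Set A) ⊆ (toBase 𝒜 _).asIdeal := h
    exact hgP (h2 ▸ h3 (mem_vertexIdeal_of_mem 𝒜 hn hg))

/-- The weighted blow-up is regular at the generic point of `E ∩ Z'` if some nearby point of `A`,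
other than the vertex, is regular. -/
theorem isRegularLocalRing_stalk_leadingPoint [IsDomain A] (T : DegreeOneUnit 𝒜 P)
    (hreg : IsRegularLocalRing (Localization.AtPrime T.shiftPrime)) :
    IsRegularLocalRing
      ((Proj (reesGrading 𝒜)).presheaf.stalk (leadingPoint hP hn hg hgP)) := by
  -- The polynomial ring localized at the origin is the common model: `e₁` identifies it with a
  -- local ring of `A`, `e₂` with the stalk of the blow-up.
  let e₁ := RingEquiv.ofBijective _ T.localRingHom_bijective
  let e₂ := RingEquiv.ofBijective _ T.ofLocalization_bijective
  let e₃ : (Proj (reesGrading 𝒜)).presheaf.stalk (leadingPoint hP hn hg hgP) ≃+*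
      ReesLocal 𝒜 P := Proj.stalkIso' (reesGrading 𝒜) (leadingPoint hP hn hg hgP)
  exact IsRegularLocalRing.of_ringEquiv ((e₁.trans e₂).trans e₃.symm)

/-- If two homogeneous elements outside the ideal of `X'` have consecutive degrees, then `E ∩ Z'`
is not contained in the singular locus of the weighted blow-up. -/
theorem conditionStar_of_degreeOneUnit [IsDomain A] {f : A} (hf : f ∈ P)
    (hA_isol : HasIsolatedSingularityAt A (vertexIdeal 𝒜)) (hP : P.IsHomogeneous 𝒜)
    (T : DegreeOneUnit 𝒜 P) : ConditionStar 𝒜 f := by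
  have hpos := Nat.succ_pos T.deg
  intro h
  have hne : T.shiftPrime ≠ vertexIdeal 𝒜 := fun h =>
    T.notMem_shiftPrime T.num_mem T.num_notMem
      (h ▸ mem_vertexIdeal_of_mem 𝒜 hpos T.num_mem)
  exact h ⟨leadingPoint_mem_exceptionalSet hP hpos T.num_mem T.num_notMem,
    leadingPoint_mem_properTransform hP hpos T.num_mem T.num_notMem hf⟩
    (isRegularLocalRing_stalk_leadingPoint hP hpos T.num_mem T.num_notMem T
      (hA_isol T.shiftPrime hne))

end Geometry

end WeightBlowUp

/-! ### The two cases of the proposition -/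

theorem proposition1p1 {A : Type u} [CommRing A] [Algebra ℂ A]
    (𝒜 : ℕ → Submodule ℂ A) [GradedAlgebra 𝒜]
    -- a minimal set of homogeneous generators `z i`, of positive weights `m i` with gcd `1`
    {t : ℕ} (z : Fin t → A) (m : Fin t → ℕ)
    (hm_pos : ∀ i, 0 < m i)
    (hz_mem : ∀ i, z i ∈ 𝒜 (m i))
    (hz_gen : Algebra.adjoin ℂ (Set.range z) = ⊤)
    (hz_min : ∀ i, z i ∉ Algebra.adjoin ℂ (z '' {i}ᶜ))
    (hm_gcd : Finset.univ.gcd m = 1)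
    -- `X = Spec A` is normal with isolated singularity
    (hA_normal : IsNormalRing A)
    (hA_isol : HasIsolatedSingularityAt A (WeightBlowUp.vertexIdeal 𝒜))
    -- `X' = Spec A/(f)`, with `f` homogeneous, is normal with isolated singularity
    {d : ℕ} (f : A) (hf_mem : f ∈ 𝒜 d)
    (hf_normal : IsNormalRing (A ⧸ Ideal.span {f}))
    (hf_isol : HasIsolatedSingularityAt (A ⧸ Ideal.span {f})
      ((WeightBlowUp.vertexIdeal 𝒜).map (Ideal.Quotient.mk (Ideal.span {f}))))
    (hcase : (∃ j, f = z j ∧ (Finset.univ.erase j).gcd m = 1) ∨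
      f ∈ (WeightBlowUp.vertexIdeal 𝒜) ^ 2) :
    WeightBlowUp.ConditionStar 𝒜 f := by
  classical
  have hconn := WeightBlowUp.exists_sub_algebraMap_mem_vertexIdeal 𝒜 hm_pos hz_mem hz_gen
  have hnontrivial : Nontrivial A := by
    -- In the zero ring either there are no generators, and the gcd is `0`, or some generator is
    -- `0`, against minimality.
    by_contra h
    rw [not_nontrivial_iff_subsingleton] at h
    rcases Finset.eq_empty_or_nonempty (Finset.univ : Finset (Fin t)) with h0 | ⟨i, -⟩
    · rw [h0, Finset.gcd_empty] at hm_gcd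
      exact zero_ne_one hm_gcd
    · exact hz_min i (by rw [Subsingleton.elim (z i) 0]; exact zero_mem _)
  have hdomain : IsDomain A := by
    have h := WeightBlowUp.ker_isPrime_of_isNormalRing hconn (RingHom.id A)
      Function.surjective_id
      (by rw [(RingHom.injective_iff_ker_eq_bot _).mp Function.injective_id]
          exact Ideal.IsHomogeneous.bot 𝒜)
      (by rw [(RingHom.injective_iff_ker_eq_bot _).mp Function.injective_id]
          exact bot_le) hA_normal
    rw [(RingHom.injective_iff_ker_eq_bot _).mp Function.injective_id] at h
    exact IsDomain.of_bot_isPrime A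
  have hfhom : (Ideal.span {f}).IsHomogeneous 𝒜 :=
    Ideal.homogeneous_span 𝒜 _ (by rintro x rfl; exact ⟨d, hf_mem⟩)
  have hfv : f ∈ WeightBlowUp.vertexIdeal 𝒜 := by
    rcases hcase with ⟨j, rfl, -⟩ | h
    · exact WeightBlowUp.mem_vertexIdeal_of_mem 𝒜 (hm_pos j) (hz_mem j)
    · exact Ideal.pow_le_self two_ne_zero h
  have hP : (Ideal.span {f}).IsPrime := by
    have h := WeightBlowUp.ker_isPrime_of_isNormalRing hconn (Ideal.Quotient.mk (Ideal.span {f}))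
      Ideal.Quotient.mk_surjective (by rwa [Ideal.mk_ker])
      (by rwa [Ideal.mk_ker, Ideal.span_singleton_le_iff_mem]) hf_normal
    rwa [Ideal.mk_ker] at h
  -- This is the only point where the two cases differ: a generator other than `z j` is not a
  -- multiple of `z j`, and no generator lies in the square of the vertex ideal, which contains
  -- `(f)` in the second case.
  obtain ⟨S, hS, hgcd⟩ : ∃ S : Finset (Fin t),
      (∀ i ∈ S, z i ∉ Ideal.span {f}) ∧ S.gcd m = 1 := by
    rcases hcase with ⟨j, rfl, hj⟩ | h
    · refine ⟨Finset.univ.erase j, fun i hi => ?_, hj⟩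
      exact WeightBlowUp.notMem_span_singleton hm_pos hz_mem hz_gen
        (Finset.ne_of_mem_erase hi).symm (hz_min i)
    · refine ⟨Finset.univ, fun i _ hi => ?_, hm_gcd⟩
      exact WeightBlowUp.notMem_vertexIdeal_sq hz_mem hz_gen i (hz_min i)
        ((Ideal.span_singleton_le_iff_mem _).mpr h hi)
  obtain ⟨k, g₀, g₁, h0, h1, h0P, h1P⟩ :=
    WeightBlowUp.exists_consecutive_degrees hz_mem (Ideal.span {f}) S hS hgcd
  exact WeightBlowUp.conditionStar_of_degreeOneUnit (Ideal.mem_span_singleton_self f) hA_isol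
    hfhom ⟨k, g₁, g₀, h1, h0, h1P, h0P⟩
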